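/- Let $q$ be a complex number with $0<|q|<1$. For a positive integer $m$ put $J_m:=\prod_{i=1}^{\infty}(1-q^{mi})$, and for positive integers $a,b,c$ and nonzero complex numbers $x,y$ put $$f_{a,b,c}(x,y,q):=\Big(\sum_{r,s\ge 0}-\sum_{r,s<0}\Big)(-1)^{r+s}x^ry^sq^{a\binom{r}{2}+brs+c\binom{s}{2}},\qquad \binom{r}{2}=\frac{r(r-1)}{2},$$ where $r,s$ run over the integers. For $k\in\mathbb{Z}$ define $$a_k:=f_{4,4,1}(-q^{4+k},q^{2+k},q)-q^{-k}f_{4,4,1}(-q^{4-k},q^{2-k},q),$$ $$b_k:=f_{3,3,1}(-q^{3+k},q^{2+k},q)-q^{-k}f_{3,3,1}(-q^{3-k},q^{2-k},q).$$ Then the double series defining $a_k$ and $b_k$ converge absolutely for all $k\in\mathbb{Z}$, the products $J_m$ converge for all $m\ge 1$, $J_2\neq 0$, and $$a_0=0,\qquad a_1=-q^{-1}J_1^2,\qquad a_2=0,\qquad a_3=q^{-3}J_1^2,$$ $$b_0=0,\qquad b_1=-q^{-1}\frac{J_1^3}{J_2},\qquad b_2=q^{-2}\frac{J_1^3}{J_2}.$$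 -/

import Mathlib

/-- The summand `(-1)^(r+s) x^r y^s q^(a*binom(r,2) + b*r*s + c*binom(s,2))`, for integers `r`, `s`.
Here `r * (r - 1)` is always even, so that the integer division by `2` is exact. -/
noncomputable def heckeTerm (a b c : ℕ) (x y q : ℂ) (r s : ℤ) : ℂ :=
  (-1) ^ (r + s) * x ^ r * y ^ s *
    q ^ ((a : ℤ) * (r * (r - 1) / 2) + (b : ℤ) * r * s + (c : ℤ) * (s * (s - 1) / 2))

/-- The double sum of the summands over `r, s ≥ 0` and the one over `r, s < 0` converge absolutely
(unconditional summability in `ℂ` is absolute summability). The negative integers are written as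
`-n - 1` with `n : ℕ`. -/
def HeckeSummable (a b c : ℕ) (x y q : ℂ) : Prop :=
  Summable (fun p : ℕ × ℕ => heckeTerm a b c x y q (p.1 : ℤ) (p.2 : ℤ)) ∧
  Summable (fun p : ℕ × ℕ => heckeTerm a b c x y q (-(p.1 : ℤ) - 1) (-(p.2 : ℤ) - 1))

/-- The Hecke-type double sum
`f_{a,b,c}(x,y,q) = (∑_{r,s ≥ 0} - ∑_{r,s < 0}) (-1)^(r+s) x^r y^s q^(a*binom(r,2)+b*r*s+c*binom(s,2))`. -/
noncomputable def heckeF (a b c : ℕ) (x y q : ℂ) : ℂ :=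
  (∑' p : ℕ × ℕ, heckeTerm a b c x y q (p.1 : ℤ) (p.2 : ℤ)) -
  ∑' p : ℕ × ℕ, heckeTerm a b c x y q (-(p.1 : ℤ) - 1) (-(p.2 : ℤ) - 1)

/-- `J_m = ∏_{i ≥ 1} (1 - q^(m*i))`. -/
noncomputable def eulerJ (m : ℕ) (q : ℂ) : ℂ :=
  ∏' i : ℕ, (1 - q ^ (m * (i + 1)))

/-- `a_k = f_{4,4,1}(-q^(4+k), q^(2+k), q) - q^(-k) f_{4,4,1}(-q^(4-k), q^(2-k), q)`. -/
noncomputable def aSeq (q : ℂ) (k : ℤ) : ℂ :=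
  heckeF 4 4 1 (-q ^ (4 + k)) (q ^ (2 + k)) q -
    q ^ (-k) * heckeF 4 4 1 (-q ^ (4 - k)) (q ^ (2 - k)) q

/-- `b_k = f_{3,3,1}(-q^(3+k), q^(2+k), q) - q^(-k) f_{3,3,1}(-q^(3-k), q^(2-k), q)`. -/
noncomputable def bSeq (q : ℂ) (k : ℤ) : ℂ :=
  heckeF 3 3 1 (-q ^ (3 + k)) (q ^ (2 + k)) q -
    q ^ (-k) * heckeF 3 3 1 (-q ^ (3 - k)) (q ^ (2 - k)) q

open Filter Topology Finset

/-! Write `q = p ^ 2`, so that all exponents become integral, and sum along `n = r + s`. The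
exponent becomes `w n - e s + 2 * k * n` with `w (-n - 1) = w n`, so the sum over negative indices
folds onto the sum over nonnegative ones. The combinations `aSeq` and `bSeq` are chosen so that the
two halves merge: each equals `∑ (p ^ (w n + 2kn) - p ^ (w n - 2k(n+1))) * P n`, with `P n =
thetaPartial p e n` (`hasSum_indefTheta_sub`).

For `k = 1` this is, up to a power of `p`, the limit of a finite identity of Bailey type, with
weights `1 / ((q)_(n-r) (q)_(n+r+1))`. The finite identities (`sum_thetaPartial_pentagonal`,
`sum_thetaPartial_square`) go by induction on `n`: the change from `n` to `n + 1` is a sum that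
vanishes after summation by parts (`sum_sub_mul_eq_zero`). Dominated convergence then produces the
Euler products.

The other values need no products. By the infinite form of summation by parts
(`tsum_sub_mul_eq_zero`), `a_2`, `q^3 a_3 + q a_1` and `q^2 b_2 + q b_1` all vanish. For `k = 0` the
two terms cancel. -/

/-- The finite product `(1 - q) (1 - q ^ 2) ⋯ (1 - q ^ n)`. -/
noncomputable def qFactorial (q : ℂ) (n : ℕ) : ℂ := ∏ i ∈ range n, (1 - q ^ (i + 1))

/-- The reciprocal of `qFactorial q m`, extended by zero to negative `m`. -/
noncomputable def qFactorialInv (q : ℂ) (m : ℤ) : ℂ :=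
  if m < 0 then 0 else (qFactorial q m.toNat)⁻¹

/-- The partial sum `∑ (-1) ^ s p ^ (-e s)` over `-n ≤ s ≤ n`. -/
noncomputable def thetaPartial (p : ℂ) (e : ℤ → ℤ) (n : ℕ) : ℂ :=
  ∑ s ∈ range (n + 1), (-1) ^ s * p ^ (-e s) +
    ∑ s ∈ range n, (-1) ^ (s + 1) * p ^ (-e (-((s : ℤ) + 1)))

/-! ### Finite q-factorials, Euler products and their limits. -/

lemma one_sub_pow_ne_zero {q : ℂ} (hq : ‖q‖ < 1) {n : ℕ} (hn : n ≠ 0) : 1 - q ^ n ≠ 0 := by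
  intro h
  have h1 : ‖q ^ n‖ < 1 := by
    rw [norm_pow]; exact pow_lt_one₀ (norm_nonneg _) hq hn
  rw [← sub_eq_zero.mp h] at h1
  simp at h1

lemma qFactorial_ne_zero {q : ℂ} (hq : ‖q‖ < 1) (n : ℕ) : qFactorial q n ≠ 0 :=
  prod_ne_zero_iff.mpr fun _ _ => one_sub_pow_ne_zero hq (Nat.succ_ne_zero _)

lemma qFactorialInv_of_neg {q : ℂ} {m : ℤ} (hm : m < 0) : qFactorialInv q m = 0 := if_pos hm

lemma qFactorialInv_natCast (q : ℂ) (n : ℕ) : qFactorialInv q n = (qFactorial q n)⁻¹ := by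
  simp [qFactorialInv]

lemma qFactorialInv_sub_one {q : ℂ} (hq : ‖q‖ < 1) (m : ℤ) :
    qFactorialInv q (m - 1) = (1 - q ^ m) * qFactorialInv q m := by
  rcases lt_trichotomy m 0 with h | rfl | h
  · rw [qFactorialInv_of_neg h, qFactorialInv_of_neg (by omega), mul_zero]
  · simp [qFactorialInv]
  · obtain ⟨n, rfl⟩ : ∃ n : ℕ, m = n + 1 := ⟨(m - 1).toNat, by omega⟩
    have h1 : qFactorialInv q ((n : ℤ) + 1) = (qFactorial q (n + 1))⁻¹ := by
      exact_mod_cast qFactorialInv_natCast q (n + 1)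
    have h2 : (1 : ℂ) - q ^ ((n : ℤ) + 1) = 1 - q ^ (n + 1) := by norm_cast
    have h3 := one_sub_pow_ne_zero hq (Nat.succ_ne_zero n)
    have h4 := qFactorial_ne_zero hq n
    rw [h1, h2, add_sub_cancel_right, qFactorialInv_natCast, qFactorial, qFactorial,
      prod_range_succ, ← qFactorial]
    field_simp

lemma summable_pow_mul_succ {q : ℂ} (hq : ‖q‖ < 1) {m : ℕ} (hm : 0 < m) :
    Summable fun i : ℕ => ‖-q ^ (m * (i + 1))‖ := by
  simp only [norm_neg, norm_pow, pow_mul]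
  have h : ‖q‖ ^ m < 1 := pow_lt_one₀ (norm_nonneg _) hq hm.ne'
  exact (summable_nat_add_iff 1).mpr (summable_geometric_of_lt_one (by positivity) h)

lemma multipliable_eulerJ {q : ℂ} (hq : ‖q‖ < 1) {m : ℕ} (hm : 0 < m) :
    Multipliable fun i : ℕ => 1 - q ^ (m * (i + 1)) := by
  simpa only [sub_eq_add_neg] using multipliable_one_add_of_summable (summable_pow_mul_succ hq hm)

lemma eulerJ_ne_zero {q : ℂ} (hq : ‖q‖ < 1) {m : ℕ} (hm : 0 < m) : eulerJ m q ≠ 0 := by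
  have h := tprod_one_add_ne_zero_of_summable (f := fun i : ℕ => -q ^ (m * (i + 1))) (fun i => by
    rw [← sub_eq_add_neg]
    exact one_sub_pow_ne_zero hq (by positivity)) (summable_pow_mul_succ hq hm)
  simpa only [sub_eq_add_neg, eulerJ] using h

lemma tendsto_qFactorial_pow {q : ℂ} (hq : ‖q‖ < 1) {m : ℕ} (hm : 0 < m) :
    Tendsto (qFactorial (q ^ m)) atTop (𝓝 (eulerJ m q)) := by
  have h := (multipliable_eulerJ hq hm).tendsto_prod_tprod_nat
  simp only [pow_mul] at h
  simp only [eulerJ, pow_mul]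
  exact h

lemma tendsto_qFactorial {q : ℂ} (hq : ‖q‖ < 1) :
    Tendsto (qFactorial q) atTop (𝓝 (eulerJ 1 q)) := by
  simpa using tendsto_qFactorial_pow hq one_pos

lemma tendsto_qFactorialInv {q : ℂ} (hq : ‖q‖ < 1) :
    Tendsto (fun n : ℕ => qFactorialInv q n) atTop (𝓝 (eulerJ 1 q)⁻¹) := by
  simp only [qFactorialInv_natCast]
  exact (tendsto_qFactorial hq).inv₀ (eulerJ_ne_zero hq one_pos)

lemma exists_norm_qFactorialInv_le {q : ℂ} (hq : ‖q‖ < 1) :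
    ∃ C, 0 ≤ C ∧ ∀ m : ℤ, ‖qFactorialInv q m‖ ≤ C := by
  obtain ⟨C, hC⟩ := (tendsto_qFactorialInv hq).norm.bddAbove_range
  have hC' : ∀ n : ℕ, ‖qFactorialInv q n‖ ≤ C := fun n => hC ⟨n, rfl⟩
  have h0 : 0 ≤ C := (norm_nonneg _).trans (hC' 0)
  refine ⟨C, h0, fun m => ?_⟩
  rcases lt_or_ge m 0 with h | h
  · rwa [qFactorialInv_of_neg h, norm_zero]
  · lift m to ℕ using h
    exact hC' m

/-- If `∑ W r` converges, then `∑ W r / ((q)_(n-r) (q)_(n+r+1))` tends to `∑ W r / (q)_∞ ^ 2`. -/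
lemma tendsto_sum_qFactorialInv {q : ℂ} (hq : ‖q‖ < 1) {W : ℕ → ℂ} (hW : Summable W) :
    Tendsto (fun n : ℕ => ∑ r ∈ range (n + 1),
      W r * (qFactorialInv q (n - r) * qFactorialInv q (n + r + 1))) atTop
      (𝓝 ((∑' r, W r) * (eulerJ 1 q)⁻¹ ^ 2)) := by
  obtain ⟨C, hC0, hC⟩ := exists_norm_qFactorialInv_le hq
  have hs : ∀ n : ℕ, ∑ r ∈ range (n + 1),
      W r * (qFactorialInv q (n - r) * qFactorialInv q (n + r + 1)) =
      ∑' r : ℕ, W r * (qFactorialInv q (n - r) * qFactorialInv q (n + r + 1)) := by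
    -- The reciprocal vanishes at negative arguments, so the finite sum is a full series, to which
    -- dominated convergence applies.
    intro n
    refine (tsum_eq_sum fun r hr => ?_).symm
    rw [mem_range, not_lt] at hr
    rw [qFactorialInv_of_neg (by omega : (n : ℤ) - r < 0), zero_mul, mul_zero]
  simp only [hs]
  rw [← tsum_mul_right]
  refine tendsto_tsum_of_dominated_convergence (bound := fun r => ‖W r‖ * (C * C))
    (hW.norm.mul_right _) (fun r => ?_) (Eventually.of_forall fun n r => ?_)
  · rw [sq]
    refine Tendsto.const_mul _ (Tendsto.mul ?_ ?_)
    · rw [← tendsto_add_atTop_iff_nat r]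
      simpa using tendsto_qFactorialInv hq
    · have h := (tendsto_add_atTop_iff_nat (r + 1)).mpr (tendsto_qFactorialInv hq)
      refine h.congr fun n => ?_
      push_cast
      rw [add_assoc]
  · rw [norm_mul, norm_mul]
    gcongr <;> apply hC

/-! ### Partial theta sums and summation by parts. -/

lemma thetaPartial_succ_sub (p : ℂ) (e : ℤ → ℤ) (n : ℕ) :
    thetaPartial p e (n + 1) - thetaPartial p e n =
      (-1) ^ (n + 1) * (p ^ (-e (n + 1)) + p ^ (-e (-((n : ℤ) + 1)))) := by
  simp only [thetaPartial]
  rw [sum_range_succ _ (n + 1),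
    sum_range_succ (fun s : ℕ => (-1) ^ (s + 1) * p ^ (-e (-((s : ℤ) + 1)))) n]
  push_cast
  ring

lemma thetaPartial_zero (p : ℂ) {e : ℤ → ℤ} (he : e 0 = 0) : thetaPartial p e 0 = 1 := by
  simp [thetaPartial, he]

/-- Summation by parts, in telescoped form. -/
lemma sum_sub_mul_eq {h P R : ℕ → ℂ} (h0 : R 0 = h 0 * P 0)
    (hs : ∀ n, R (n + 1) - R n = h (n + 1) * (P (n + 1) - P n)) (N : ℕ) :
    ∑ n ∈ range N, (h (n + 1) - h n) * P n = h N * P N - R N := by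
  induction N with
  | zero => simp [h0]
  | succ N ih =>
    rw [sum_range_succ, ih]
    linear_combination hs N

lemma zpow_eq_mul {p : ℂ} (hp : p ≠ 0) {a b c : ℤ} (h : a = b + c) : p ^ a = p ^ b * p ^ c := by
  rw [h, zpow_add₀ hp]

/-- The products `G (n + 1) * (P (n + 1) - P n)` have an explicit antidifference `R`, a multiple of
`(-1)^N q^(m + N(N+1)/2) / ((q)_(m-N-1) (q)_(m+N))` with `q = p ^ 2`. The boundary terms vanish
because `1 / (q)_j` is zero for `j < 0`. The factor `1 / (1 - q^m)` in `R` is why `m = 0` is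
excluded. -/
lemma sum_sub_mul_eq_zero {p : ℂ} (hp : p ≠ 0) (hp1 : ‖p ^ 2‖ < 1) {m : ℕ} (hm : m ≠ 0) (c : ℂ)
    {G P : ℕ → ℂ} (h0 : G 0 * P 0 = c * (p ^ (2 * m : ℤ) * qFactorialInv (p ^ 2) m ^ 2))
    (hs : ∀ n : ℕ, G (n + 1) * (P (n + 1) - P n) = c * ((-1) ^ (n + 1) *
      (p ^ (2 * m + (n + 1) * n : ℤ) * (1 + p ^ (2 * (n + 1) : ℤ)) *
        (qFactorialInv (p ^ 2) (m - (n + 1)) * qFactorialInv (p ^ 2) (m + (n + 1))))))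
    (hG : G (m + 1) = 0) :
    ∑ r ∈ range (m + 1), (G (r + 1) - G r) * P r = 0 := by
  have hκ : 1 - (p ^ 2) ^ m ≠ 0 := one_sub_pow_ne_zero hp1 hm
  have hq : ∀ k : ℤ, (p ^ 2) ^ k = p ^ (2 * k) := fun k => by rw [zpow_mul]; norm_cast
  have hκ' : 1 - p ^ (2 * m : ℤ) ≠ 0 := by rw [← hq]; exact_mod_cast hκ
  rw [sum_sub_mul_eq (R := fun N : ℕ => c * ((1 - p ^ (2 * m : ℤ))⁻¹ * ((-1) ^ N *
    p ^ (2 * m + N * (N + 1) : ℤ) *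
      (qFactorialInv (p ^ 2) (m - N - 1) * qFactorialInv (p ^ 2) (m + N)))))]
  · rw [hG, qFactorialInv_of_neg (by push_cast; omega)]
    ring
  · rw [h0]
    have h1 := qFactorialInv_sub_one hp1 m
    simp only [Nat.cast_zero, sub_zero, add_zero, zero_mul, h1, hq]
    field_simp
  · intro n
    rw [hs]
    have h1 := qFactorialInv_sub_one hp1 (m - (n + 1))
    have h2 := qFactorialInv_sub_one hp1 (m + (n + 1))
    rw [show (m : ℤ) + (n + 1) - 1 = m + n by ring] at h2
    push_cast
    rw [h1, show (m : ℤ) - n - 1 = m - (n + 1) by ring, h2, hq, hq,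
      zpow_eq_mul hp (show (2 * m + (n + 1) * (n + 1 + 1) : ℤ) =
        (2 * m + n * (n + 1)) + 2 * (n + 1) by ring),
      show (2 * m + (n + 1) * n : ℤ) = 2 * m + n * (n + 1) by ring,
      zpow_eq_mul hp (show (2 * (m + (n + 1)) : ℤ) = 2 * m + 2 * (n + 1) by ring),
      show (2 * (m - (n + 1)) : ℤ) = 2 * m + -(2 * (n + 1)) by ring, zpow_add₀ hp (2 * m : ℤ)
        (-(2 * (n + 1))), zpow_neg]
    have hX : p ^ (2 * (n + 1) : ℤ) ≠ 0 := zpow_ne_zero _ hp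
    field_simp
    ring

lemma sq_zpow (p : ℂ) (k : ℤ) : (p ^ 2) ^ k = p ^ (2 * k) := by
  rw [zpow_mul]; norm_cast

/-! ### Finite Hecke-type identities and their limits. -/

/-- The finite form of the Hecke-type expansion of `J_1 ^ 2`. -/
lemma sum_thetaPartial_pentagonal {p : ℂ} (hp : p ≠ 0) (hp1 : ‖p ^ 2‖ < 1) (n : ℕ) :
    ∑ r ∈ range (n + 1), (p ^ (4 * r ^ 2 + 2 * r : ℤ) * (1 - p ^ (4 * r + 2 : ℤ)) *
      thetaPartial p (fun s => s * (3 * s + 1)) r) *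
      (qFactorialInv (p ^ 2) (n - r) * qFactorialInv (p ^ 2) (n + r + 1)) = 1 := by
  set P := thetaPartial p (fun s => s * (3 * s + 1)) with hPdef
  set I := qFactorialInv (p ^ 2) with hI
  have hP0 : P 0 = 1 := thetaPartial_zero p (by norm_num)
  induction n with
  | zero =>
    have hI0 : I 0 = 1 := by simp [hI, qFactorialInv, qFactorial]
    have hI1 := qFactorialInv_sub_one hp1 1
    rw [← hI, sub_self, hI0] at hI1
    rw [zpow_one] at hI1
    simp [hP0, hI0]
    exact_mod_cast hI1.symm
  | succ k ih =>
    -- `G` is chosen so that `(G (r + 1) - G r) * P r` is the `r`-th summand at level `k` minus the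
    -- one at level `k + 1`.
    have hz := sum_sub_mul_eq_zero hp hp1 (Nat.succ_ne_zero k) 1
      (G := fun r => p ^ (2 * (k + 1 : ℕ) + 4 * r ^ 2 : ℤ) *
        (I ((k + 1 : ℕ) - r) * I ((k + 1 : ℕ) + r))) (P := P) (by
          rw [hP0, ← hI]; simp [sq]) (fun n => by
          rw [hPdef, thetaPartial_succ_sub, ← hI]
          push_cast
          rw [zpow_eq_mul hp (show (2 * (k + 1) + 4 * (n + 1) ^ 2 : ℤ) =
              (2 * (k + 1) + (n + 1) * n) + (n + 1) * (3 * (n + 1) + 1) by ring),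
            zpow_eq_mul hp (show (-(-((n : ℤ) + 1) * (3 * -((n : ℤ) + 1) + 1))) =
              (-((n + 1) * (3 * (n + 1) + 1))) + 2 * (n + 1) by ring), zpow_neg]
          have hX : p ^ ((n + 1) * (3 * (n + 1) + 1) : ℤ) ≠ 0 := zpow_ne_zero _ hp
          field_simp) (by
          rw [hI, qFactorialInv_of_neg (by push_cast; omega), zero_mul, mul_zero])
    refine Eq.trans ?_ ih
    rw [← sub_eq_zero]
    -- The level `k` sum may be extended to `r = k + 1`, where its summand contains `1 / (q)_(-1) =
    -- 0`.
    have hext : ∀ f : ℕ → ℂ, f (k + 1) = 0 →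
        ∑ r ∈ range (k + 1), f r = ∑ r ∈ range (k + 1 + 1), f r := by
      intro f hf
      rw [sum_range_succ _ (k + 1), hf, add_zero]
    rw [hext _ (by rw [hI, qFactorialInv_of_neg (by push_cast; omega), zero_mul, mul_zero]),
      ← sum_sub_distrib, ← neg_eq_zero, ← hz, ← sum_neg_distrib]
    refine sum_congr rfl fun r _ => ?_
    have h1 := qFactorialInv_sub_one hp1 ((k : ℤ) + 1 - r)
    have h2 := qFactorialInv_sub_one hp1 ((k : ℤ) + 1 + r + 1)
    rw [← hI, sq_zpow] at h1 h2
    rw [show (k : ℤ) + 1 - r - 1 = k - r by ring] at h1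
    rw [show (k : ℤ) + 1 + r + 1 - 1 = k + r + 1 by ring] at h2
    push_cast
    rw [h1, show (k : ℤ) + 1 + (r + 1) = k + 1 + r + 1 by ring,
      show (k : ℤ) + 1 - (r + 1) = k - r by ring, show (k : ℤ) + 1 + r = k + r + 1 by ring, h1, h2,
      zpow_eq_mul hp (show (2 * (k + 1) + 4 * (r + 1) ^ 2 : ℤ) =
        2 * (k + 1) + (4 * r ^ 2 + (2 * r + (2 * r + (2 * r + (2 * r + 4))))) by ring),
      zpow_eq_mul hp (show (2 * (k + 1 - r) : ℤ) = 2 * (k + 1) + -(2 * r) by ring),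
      zpow_eq_mul hp (show (2 * (k + 1 + r + 1) : ℤ) = 2 * (k + 1) + (2 * r + 2) by ring),
      show (4 * r + 2 : ℤ) = 2 * r + (2 * r + 2) by ring]
    simp only [zpow_add₀ hp (2 * (r : ℤ)), zpow_add₀ hp (4 * (r : ℤ) ^ 2),
      zpow_add₀ hp (2 * ((k : ℤ) + 1)), zpow_neg]
    have hX : p ^ (2 * r : ℤ) ≠ 0 := zpow_ne_zero _ hp
    rw [show p ^ (4 : ℤ) = p ^ 4 by norm_cast, show p ^ (2 : ℤ) = p ^ 2 by norm_cast]
    field_simp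
    ring_nf

/-- The finite form of the Hecke-type expansion of `J_1 ^ 3 / J_2`. -/
lemma sum_thetaPartial_square {p : ℂ} (hp : p ≠ 0) (hp1 : ‖p ^ 2‖ < 1) (n : ℕ) :
    (∑ r ∈ range (n + 1), (p ^ (r * (3 * r + 1) : ℤ) * (1 - p ^ (4 * r + 2 : ℤ)) *
      thetaPartial p (fun s => 2 * s ^ 2) r) *
      (qFactorialInv (p ^ 2) (n - r) * qFactorialInv (p ^ 2) (n + r + 1))) *
      ∏ i ∈ range n, (1 + (p ^ 2) ^ (i + 1)) = 1 := by
  set P := thetaPartial p (fun s => 2 * s ^ 2) with hPdef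
  set I := qFactorialInv (p ^ 2) with hI
  have hP0 : P 0 = 1 := thetaPartial_zero p (by norm_num)
  induction n with
  | zero =>
    have hI0 : I 0 = 1 := by simp [hI, qFactorialInv, qFactorial]
    have hI1 := qFactorialInv_sub_one hp1 1
    rw [← hI, sub_self, hI0] at hI1
    rw [zpow_one] at hI1
    simp [hP0, hI0]
    exact_mod_cast hI1.symm
  | succ k ih =>
    -- The level `k + 1` summand is now weighted by `1 + q^(k+1)`, the new factor of the product.
    -- The constant `2` is the value of `1 + p ^ (2 * r)` at `r = 0`.
    have hz := sum_sub_mul_eq_zero hp hp1 (Nat.succ_ne_zero k) 2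
      (G := fun r => p ^ (2 * (k + 1 : ℕ) + r * (3 * r - 1) : ℤ) * (1 + p ^ (2 * r : ℤ)) *
        (I ((k + 1 : ℕ) - r) * I ((k + 1 : ℕ) + r))) (P := P) (by
          rw [hP0, ← hI]; simp; ring) (fun n => by
          rw [hPdef, thetaPartial_succ_sub, ← hI]
          push_cast
          rw [zpow_eq_mul hp (show (2 * (k + 1) + (n + 1) * (3 * (n + 1) - 1) : ℤ) =
              (2 * (k + 1) + (n + 1) * n) + 2 * (n + 1) ^ 2 by ring),
            show (-(2 * (-((n : ℤ) + 1)) ^ 2)) = (-(2 * (n + 1) ^ 2)) by ring, zpow_neg]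
          have hX : p ^ (2 * (n + 1) ^ 2 : ℤ) ≠ 0 := zpow_ne_zero _ hp
          field_simp
          ring) (by
          rw [hI, qFactorialInv_of_neg (by push_cast; omega), zero_mul, mul_zero])
    refine Eq.trans ?_ ih
    rw [prod_range_succ, mul_comm (∏ i ∈ range k, _), ← mul_assoc, ← sub_eq_zero,
      ← sub_mul, mul_eq_zero]
    left
    have hext : ∀ f : ℕ → ℂ, f (k + 1) = 0 →
        ∑ r ∈ range (k + 1), f r = ∑ r ∈ range (k + 1 + 1), f r := by
      intro f hf
      rw [sum_range_succ _ (k + 1), hf, add_zero]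
    rw [hext _ (by rw [hI, qFactorialInv_of_neg (by push_cast; omega), zero_mul, mul_zero]),
      sum_mul, ← sum_sub_distrib, ← neg_eq_zero, ← hz, ← sum_neg_distrib]
    refine sum_congr rfl fun r _ => ?_
    have h1 := qFactorialInv_sub_one hp1 ((k : ℤ) + 1 - r)
    have h2 := qFactorialInv_sub_one hp1 ((k : ℤ) + 1 + r + 1)
    rw [← hI, sq_zpow] at h1 h2
    rw [show (k : ℤ) + 1 - r - 1 = k - r by ring] at h1
    rw [show (k : ℤ) + 1 + r + 1 - 1 = k + r + 1 by ring] at h2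
    have h3 : (p ^ 2) ^ (k + 1) = p ^ (2 * (k + 1) : ℤ) := by
      rw [← sq_zpow]; norm_cast
    push_cast
    rw [h1, show (k : ℤ) + 1 + (r + 1) = k + 1 + r + 1 by ring,
      show (k : ℤ) + 1 - (r + 1) = k - r by ring, show (k : ℤ) + 1 + r = k + r + 1 by ring, h1, h2,
      h3,
      zpow_eq_mul hp (show (2 * (k + 1) + (r + 1) * (3 * (r + 1) - 1) : ℤ) =
        2 * (k + 1) + (r * (3 * r - 1) + (2 * r + (2 * r + (2 * r + 2)))) by ring),
      show (r * (3 * r + 1) : ℤ) = r * (3 * r - 1) + 2 * r by ring,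
      zpow_eq_mul hp (show (2 * (k + 1 - r) : ℤ) = 2 * (k + 1) + -(2 * r) by ring),
      zpow_eq_mul hp (show (2 * (k + 1 + r + 1) : ℤ) = 2 * (k + 1) + (2 * r + 2) by ring),
      show (2 * (r + 1) : ℤ) = 2 * r + 2 by ring,
      show (4 * r + 2 : ℤ) = 2 * r + (2 * r + 2) by ring]
    simp only [zpow_add₀ hp (2 * (r : ℤ)), zpow_add₀ hp (r * (3 * (r : ℤ) - 1)),
      zpow_add₀ hp (2 * ((k : ℤ) + 1)), zpow_neg]
    have hX : p ^ (2 * r : ℤ) ≠ 0 := zpow_ne_zero _ hp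
    rw [show p ^ (2 : ℤ) = p ^ 2 by norm_cast]
    field_simp
    ring_nf

lemma tsum_thetaPartial_pentagonal {p : ℂ} (hp : p ≠ 0) (hp1 : ‖p ^ 2‖ < 1)
    (hs : Summable fun r : ℕ => p ^ (4 * r ^ 2 + 2 * r : ℤ) * (1 - p ^ (4 * r + 2 : ℤ)) *
      thetaPartial p (fun s => s * (3 * s + 1)) r) :
    ∑' r : ℕ, p ^ (4 * r ^ 2 + 2 * r : ℤ) * (1 - p ^ (4 * r + 2 : ℤ)) *
      thetaPartial p (fun s => s * (3 * s + 1)) r = eulerJ 1 (p ^ 2) ^ 2 := by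
  have h := tendsto_sum_qFactorialInv hp1 hs
  simp only [sum_thetaPartial_pentagonal hp hp1] at h
  have h1 := tendsto_nhds_unique h tendsto_const_nhds
  have h2 := eulerJ_ne_zero hp1 one_pos
  field_simp at h1
  exact h1

lemma tsum_thetaPartial_square {p : ℂ} (hp : p ≠ 0) (hp1 : ‖p ^ 2‖ < 1)
    (hs : Summable fun r : ℕ => p ^ (r * (3 * r + 1) : ℤ) * (1 - p ^ (4 * r + 2 : ℤ)) *
      thetaPartial p (fun s => 2 * s ^ 2) r) :
    ∑' r : ℕ, p ^ (r * (3 * r + 1) : ℤ) * (1 - p ^ (4 * r + 2 : ℤ)) *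
      thetaPartial p (fun s => 2 * s ^ 2) r = eulerJ 1 (p ^ 2) ^ 3 / eulerJ 2 (p ^ 2) := by
  have h1 := eulerJ_ne_zero hp1 one_pos
  have h2 := eulerJ_ne_zero hp1 two_pos
  -- `1 + x = (1 - x^2) / (1 - x)` makes the product tend to `J_2 / J_1`, the source of the extra
  -- factor in the evaluation.
  have hprod : ∀ n, ∏ i ∈ range n, (1 + (p ^ 2) ^ (i + 1)) =
      qFactorial ((p ^ 2) ^ 2) n / qFactorial (p ^ 2) n := by
    intro n
    rw [eq_div_iff (qFactorial_ne_zero hp1 n), qFactorial, qFactorial, ← prod_mul_distrib]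
    refine prod_congr rfl fun i _ => ?_
    ring
  have h := (tendsto_sum_qFactorialInv hp1 hs).mul
    ((tendsto_qFactorial_pow hp1 two_pos).div (tendsto_qFactorial hp1) h1)
  have h3 := tendsto_nhds_unique (h.congr fun n => by
    rw [Pi.div_apply, ← hprod, sum_thetaPartial_square hp hp1]) tendsto_const_nhds
  rw [eq_div_iff h2]
  field_simp at h3
  exact h3

/-! ### Indefinite theta series summed along `r + s`. -/

/-- The summand of an indefinite theta series, with outer exponent `w` in `r + s` and inner
exponent `e` in `s`. -/
noncomputable def indefTerm (p : ℂ) (w e : ℤ → ℤ) (k r s : ℤ) : ℂ :=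
  (-1) ^ s * p ^ (w (r + s) - e s + 2 * k * (r + s))

lemma summable_zpow_of_le {p : ℂ} (hp : p ≠ 0) (hp1 : ‖p‖ < 1) {E : ℕ × ℕ → ℤ} {σ : ℕ × ℕ → ℤ}
    (C : ℤ) (hE : ∀ x, (x.1 : ℤ) + x.2 ≤ E x + C) :
    Summable fun x : ℕ × ℕ => (-1 : ℂ) ^ σ x * p ^ E x := by
  have h0 : 0 < ‖p‖ := norm_pos_iff.mpr hp
  have hg := summable_geometric_of_lt_one h0.le hp1
  have hg2 := ((hg.mul_of_nonneg hg (fun _ => by positivity) (fun _ => by positivity))).mul_left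
    (‖p‖ ^ (-C))
  refine Summable.of_norm_bounded hg2 fun x => ?_
  rw [norm_mul, norm_zpow, norm_zpow, norm_neg, norm_one, one_zpow, one_mul,
    ← zpow_natCast, ← zpow_natCast, ← zpow_add₀ h0.ne', ← zpow_add₀ h0.ne']
  exact zpow_le_zpow_right_of_le_one₀ h0 hp1.le (by linarith [hE x])

lemma Summable.hasSum_antidiagonal {f : ℕ × ℕ → ℂ} (hf : Summable f) :
    HasSum (fun n => ∑ s ∈ range (n + 1), f (n - s, s)) (∑' x, f x) := by
  have h := (Finset.HasAntidiagonal.sigmaAntidiagonalEquivProd (A := ℕ)).hasSum_iff.mpr hf.hasSum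
  have h2 := h.sigma (g := fun n => ∑ x ∈ antidiagonal n, f x) fun n => by
    have h3 := hasSum_fintype fun x : antidiagonal n => f x
    rw [Finset.univ_eq_attach, Finset.sum_attach (antidiagonal n) f] at h3
    exact h3
  refine h2.congr_fun fun n => ?_
  rw [← Nat.sum_antidiagonal_swap, Nat.sum_antidiagonal_eq_sum_range_succ_mk]
  rfl

lemma hasSum_indefTerm_nonneg {p : ℂ} {w e : ℤ → ℤ} (hp : p ≠ 0) {k : ℤ}
    (hs : Summable fun x : ℕ × ℕ => indefTerm p w e k x.1 x.2) :
    HasSum (fun n : ℕ => p ^ (w n + 2 * k * n) *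
      ∑ s ∈ range (n + 1), (-1) ^ s * p ^ (-e s)) (∑' x : ℕ × ℕ, indefTerm p w e k x.1 x.2) := by
  refine hs.hasSum_antidiagonal.congr_fun fun n => ?_
  rw [mul_sum]
  refine sum_congr rfl fun s hs => ?_
  have h : s ≤ n := by simpa [Nat.lt_succ_iff] using hs
  simp only [indefTerm]
  rw [Nat.cast_sub h, sub_add_cancel, zpow_natCast,
    zpow_eq_mul hp (show w n - e s + 2 * k * n = w n + 2 * k * n + -e s by ring)]
  ring

lemma hasSum_indefTerm_neg {p : ℂ} {w e : ℤ → ℤ} (hp : p ≠ 0) (hw : ∀ n, w (-n - 1) = w n) {k : ℤ}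
    (hs : Summable fun x : ℕ × ℕ => indefTerm p w e k (-(x.1 : ℤ) - 1) (-(x.2 : ℤ) - 1)) :
    HasSum (fun n : ℕ => p ^ (w n - 2 * k * (n + 1)) *
      ∑ s ∈ range n, (-1) ^ (s + 1) * p ^ (-e (-((s : ℤ) + 1))))
      (∑' x : ℕ × ℕ, indefTerm p w e k (-(x.1 : ℤ) - 1) (-(x.2 : ℤ) - 1)) := by
  -- The indices `-x - 1`, `-y - 1` have sum `-(x + y + 1) - 1`, so reflection leads to `n = x + y +
  -- 1`; the term at `n = 0` is an empty sum.
  rw [← hasSum_nat_add_iff' 1, sum_range_one, range_zero, sum_empty, mul_zero, sub_zero]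
  refine hs.hasSum_antidiagonal.congr_fun fun n => ?_
  rw [mul_sum]
  refine sum_congr rfl fun s hs => ?_
  have h : s ≤ n := by simpa [Nat.lt_succ_iff] using hs
  simp only [indefTerm]
  have hsgn : (-1 : ℂ) ^ (-(s : ℤ) - 1) = (-1) ^ (s + 1) := by
    rw [show -(s : ℤ) - 1 = -((s + 1 : ℕ) : ℤ) by push_cast; ring, zpow_neg, zpow_natCast,
      ← inv_pow, inv_neg_one]
  rw [hsgn, Nat.cast_sub h,
    show -((n : ℤ) - s) - 1 + (-(s : ℤ) - 1) = -((n : ℤ) + 1) - 1 by ring, hw,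
    show -((s : ℤ) + 1) = -(s : ℤ) - 1 by ring,
    zpow_eq_mul hp (show w (n + 1) - e (-s - 1) + 2 * k * (-((n : ℤ) + 1) - 1) =
      w (n + 1) - 2 * k * (n + 1 + 1) + -e (-s - 1) by ring)]
  push_cast
  ring

/-- Both halves of the indefinite theta series with exponents `w` and `e` converge. -/
def IndefSummable (p : ℂ) (w e : ℤ → ℤ) (k : ℤ) : Prop :=
  (Summable fun x : ℕ × ℕ => indefTerm p w e k x.1 x.2) ∧
    Summable fun x : ℕ × ℕ => indefTerm p w e k (-(x.1 : ℤ) - 1) (-(x.2 : ℤ) - 1)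

/-- The indefinite theta series with exponents `w` and `e`. -/
noncomputable def indefTheta (p : ℂ) (w e : ℤ → ℤ) (k : ℤ) : ℂ :=
  (∑' x : ℕ × ℕ, indefTerm p w e k x.1 x.2) -
    ∑' x : ℕ × ℕ, indefTerm p w e k (-(x.1 : ℤ) - 1) (-(x.2 : ℤ) - 1)

lemma summable_zpow_mul_thetaPartial {p : ℂ} {w e : ℤ → ℤ} (hp : p ≠ 0)
    (hw : ∀ n, w (-n - 1) = w n) (hs : ∀ k, IndefSummable p w e k) (k : ℤ) :
    Summable fun n : ℕ => p ^ (w n + 2 * k * n) * thetaPartial p e n := by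
  have h1 := (hasSum_indefTerm_nonneg hp (hs k).1).summable
  have h2 := (hasSum_indefTerm_neg hp hw (hs (-k)).2).summable.mul_left (p ^ (-(2 * k)))
  refine (h1.add h2).congr fun n => ?_
  rw [← mul_assoc, ← zpow_eq_mul hp (show w n + 2 * k * n =
    -(2 * k) + (w n - 2 * -k * (n + 1)) by ring), ← mul_add, thetaPartial]

/-- Multiplying by `p ^ (-(2 * k))` and replacing `k` by `-k` swaps the weights of the two halves.
The nonnegative and negative `s` then share each weight and assemble into `thetaPartial`. -/
lemma hasSum_indefTheta_sub {p : ℂ} {w e : ℤ → ℤ} (hp : p ≠ 0)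
    (hw : ∀ n, w (-n - 1) = w n) (hs : ∀ k, IndefSummable p w e k) (k : ℤ) :
    HasSum (fun n : ℕ => (p ^ (w n + 2 * k * n) - p ^ (w n - 2 * k * (n + 1))) *
      thetaPartial p e n) (indefTheta p w e k - p ^ (-(2 * k)) * indefTheta p w e (-k)) := by
  have h := ((hasSum_indefTerm_nonneg hp (hs k).1).sub
    (hasSum_indefTerm_neg hp hw (hs k).2)).sub
    (((hasSum_indefTerm_nonneg hp (hs (-k)).1).sub
      (hasSum_indefTerm_neg hp hw (hs (-k)).2)).mul_left (p ^ (-(2 * k))))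
  refine h.congr_fun fun n => ?_
  rw [mul_sub, ← mul_assoc, ← mul_assoc, ← zpow_eq_mul hp (show w n + 2 * k * n =
    -(2 * k) + (w n - 2 * -k * (n + 1)) by ring), ← zpow_eq_mul hp
    (show w n - 2 * k * (n + 1) = -(2 * k) + (w n + 2 * -k * n) by ring), thetaPartial]
  ring

lemma heckeTerm_eq_indefTerm {p : ℂ} (hp : p ≠ 0) (a : ℕ) (k : ℤ) {w e : ℤ → ℤ}
    (he : ∀ r s : ℤ, a * (r * (r - 1)) + 2 * a * r * s + s * (s - 1) + 2 * a * r + 4 * s =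
      w (r + s) - e s) (r s : ℤ) :
    heckeTerm a a 1 (-(p ^ 2) ^ ((a : ℤ) + k)) ((p ^ 2) ^ (2 + k)) (p ^ 2) r s =
      indefTerm p w e k r s := by
  obtain ⟨i, hi⟩ := (Int.even_mul_pred_self r).two_dvd
  obtain ⟨j, hj⟩ := (Int.even_mul_pred_self s).two_dvd
  have h1 : (-1 : ℂ) ^ (r + s) * (-1) ^ r = (-1) ^ s := by
    rw [← zpow_add₀ (by norm_num), show r + s + r = 2 * r + s by ring, zpow_add₀ (by norm_num),
      zpow_mul]
    norm_num
  rw [heckeTerm, indefTerm, hi, hj, Int.mul_ediv_cancel_left _ two_ne_zero,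
    Int.mul_ediv_cancel_left _ two_ne_zero,
    show -(p ^ 2) ^ ((a : ℤ) + k) = -1 * (p ^ 2) ^ ((a : ℤ) + k) by ring, mul_zpow,
    ← mul_assoc ((-1 : ℂ) ^ (r + s)), h1]
  simp only [sq_zpow, ← zpow_mul, mul_assoc ((-1 : ℂ) ^ s)]
  congr 1
  rw [← zpow_add₀ hp, ← zpow_add₀ hp, ← he, hi, hj]
  congr 1
  push_cast
  ring

lemma tendsto_neg_one_pow_mul_zpow {p : ℂ} (hp : p ≠ 0) (hp1 : ‖p‖ < 1) {E : ℕ → ℤ} (C : ℤ)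
    (hE : ∀ n : ℕ, (n : ℤ) ≤ E n + C) :
    Tendsto (fun n : ℕ => (-1 : ℂ) ^ n * p ^ E n) atTop (𝓝 0) := by
  have h0 : 0 < ‖p‖ := norm_pos_iff.mpr hp
  have h := (tendsto_pow_atTop_nhds_zero_of_lt_one h0.le hp1).const_mul (‖p‖ ^ (-C))
  rw [mul_zero] at h
  refine squeeze_zero_norm (fun n => ?_) h
  rw [norm_mul, norm_pow, norm_zpow, norm_neg, norm_one, one_pow, one_mul,
    ← zpow_natCast, ← zpow_add₀ h0.ne']
  exact zpow_le_zpow_right_of_le_one₀ h0 hp1.le (by linarith [hE n])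

/-- The partial sums are `h N * P N - R N`, and both terms tend to zero. -/
lemma tsum_sub_mul_eq_zero {h P R : ℕ → ℂ} (h0 : R 0 = h 0 * P 0)
    (hs : ∀ n, R (n + 1) - R n = h (n + 1) * (P (n + 1) - P n))
    (hP : Tendsto (fun n => h n * P n) atTop (𝓝 0)) (hR : Tendsto R atTop (𝓝 0)) {S : ℂ}
    (hS : HasSum (fun n => (h (n + 1) - h n) * P n) S) : S = 0 := by
  have h1 := hS.tendsto_sum_nat
  simp only [sum_sub_mul_eq h0 hs] at h1
  simpa using tendsto_nhds_unique h1 (hP.sub hR)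

/-- The quadratic part of the exponent is `4r^2 + 8rs + s^2`, positive when `r` and `s` have the
same sign; completing squares absorbs the linear terms. -/
lemma indefSummable_pentagonal {p : ℂ} (hp : p ≠ 0) (hp1 : ‖p‖ < 1) (k : ℤ) :
    IndefSummable p (fun n => 4 * n ^ 2 + 4 * n) (fun s => s * (3 * s + 1)) k := by
  constructor
  · refine summable_zpow_of_le hp hp1 (2 * k ^ 2) fun x => ?_
    obtain ⟨r, s⟩ := x
    have hrs : (0 : ℤ) ≤ r * s := by positivity
    dsimp only
    nlinarith [sq_nonneg ((s : ℤ) + k), sq_nonneg ((r : ℤ) + k), sq_nonneg (r : ℤ)]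
  · refine summable_zpow_of_le hp hp1 (3 * k ^ 2 + 1) fun x => ?_
    obtain ⟨r, s⟩ := x
    have hrs : (0 : ℤ) ≤ r * s := by positivity
    dsimp only
    nlinarith [sq_nonneg ((s : ℤ) + 1 - k), sq_nonneg ((r : ℤ) - k), sq_nonneg (r : ℤ),
      sq_nonneg (k - 1)]

lemma indefSummable_square {p : ℂ} (hp : p ≠ 0) (hp1 : ‖p‖ < 1) (k : ℤ) :
    IndefSummable p (fun n => 3 * n ^ 2 + 3 * n) (fun s => 2 * s ^ 2) k := by
  constructor
  · refine summable_zpow_of_le hp hp1 (2 * k ^ 2) fun x => ?_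
    obtain ⟨r, s⟩ := x
    have hrs : (0 : ℤ) ≤ r * s := by positivity
    dsimp only
    nlinarith [sq_nonneg ((s : ℤ) + k), sq_nonneg ((r : ℤ) + k), sq_nonneg (r : ℤ)]
  · refine summable_zpow_of_le hp hp1 (3 * k ^ 2 + 1) fun x => ?_
    obtain ⟨r, s⟩ := x
    have hrs : (0 : ℤ) ≤ r * s := by positivity
    dsimp only
    nlinarith [sq_nonneg ((s : ℤ) + 1 - k), sq_nonneg ((r : ℤ) - k), sq_nonneg (r : ℤ),
      sq_nonneg (k - 1)]

/-! ### The sequences `aSeq` and `bSeq` as single series, and their values. -/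

lemma heckeTerm_four {p : ℂ} (hp : p ≠ 0) (k r s : ℤ) :
    heckeTerm 4 4 1 (-(p ^ 2) ^ (4 + k)) ((p ^ 2) ^ (2 + k)) (p ^ 2) r s =
      indefTerm p (fun n => 4 * n ^ 2 + 4 * n) (fun s => s * (3 * s + 1)) k r s :=
  heckeTerm_eq_indefTerm hp 4 k (fun r s => by push_cast; ring) r s

lemma heckeTerm_three {p : ℂ} (hp : p ≠ 0) (k r s : ℤ) :
    heckeTerm 3 3 1 (-(p ^ 2) ^ (3 + k)) ((p ^ 2) ^ (2 + k)) (p ^ 2) r s =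
      indefTerm p (fun n => 3 * n ^ 2 + 3 * n) (fun s => 2 * s ^ 2) k r s :=
  heckeTerm_eq_indefTerm hp 3 k (fun r s => by push_cast; ring) r s

lemma hasSum_aSeq {p : ℂ} (hp : p ≠ 0) (hp1 : ‖p‖ < 1) (k : ℤ) :
    HasSum (fun n : ℕ => (p ^ (4 * n ^ 2 + 4 * n + 2 * k * n : ℤ) -
      p ^ (4 * n ^ 2 + 4 * n - 2 * k * (n + 1) : ℤ)) *
      thetaPartial p (fun s => s * (3 * s + 1)) n) (aSeq (p ^ 2) k) := by
  have h : aSeq (p ^ 2) k = indefTheta p (fun n => 4 * n ^ 2 + 4 * n)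
      (fun s => s * (3 * s + 1)) k - p ^ (-(2 * k)) *
      indefTheta p (fun n => 4 * n ^ 2 + 4 * n) (fun s => s * (3 * s + 1)) (-k) := by
    rw [aSeq, sub_eq_add_neg 4 k, sub_eq_add_neg 2 k, heckeF, heckeF]
    simp only [heckeTerm_four hp]
    rw [sq_zpow, mul_neg, indefTheta, indefTheta]
  rw [h]
  exact hasSum_indefTheta_sub hp (fun n => by ring) (indefSummable_pentagonal hp hp1) k

lemma hasSum_bSeq {p : ℂ} (hp : p ≠ 0) (hp1 : ‖p‖ < 1) (k : ℤ) :
    HasSum (fun n : ℕ => (p ^ (3 * n ^ 2 + 3 * n + 2 * k * n : ℤ) -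
      p ^ (3 * n ^ 2 + 3 * n - 2 * k * (n + 1) : ℤ)) *
      thetaPartial p (fun s => 2 * s ^ 2) n) (bSeq (p ^ 2) k) := by
  have h : bSeq (p ^ 2) k = indefTheta p (fun n => 3 * n ^ 2 + 3 * n)
      (fun s => 2 * s ^ 2) k - p ^ (-(2 * k)) *
      indefTheta p (fun n => 3 * n ^ 2 + 3 * n) (fun s => 2 * s ^ 2) (-k) := by
    rw [bSeq, sub_eq_add_neg 3 k, sub_eq_add_neg 2 k, heckeF, heckeF]
    simp only [heckeTerm_three hp]
    rw [sq_zpow, mul_neg, indefTheta, indefTheta]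
  rw [h]
  exact hasSum_indefTheta_sub hp (fun n => by ring) (indefSummable_square hp hp1) k

lemma tendsto_zpow_mul_thetaPartial_pentagonal {p : ℂ} (hp : p ≠ 0) (hp1 : ‖p‖ < 1) (k : ℤ) :
    Tendsto (fun n : ℕ => p ^ (4 * n ^ 2 + 2 * k * n : ℤ) *
      thetaPartial p (fun s => s * (3 * s + 1)) n) atTop (𝓝 0) := by
  -- Shifting `k` by 2 cancels the linear term `4 * n` of `w`; the terms of a convergent series tend
  -- to zero.
  have h := (summable_zpow_mul_thetaPartial hp (fun n => by ring)
    (indefSummable_pentagonal hp hp1) (k - 2)).tendsto_atTop_zero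
  refine h.congr fun n => ?_
  congr 2
  ring

lemma tendsto_zpow_mul_thetaPartial_square {p : ℂ} (hp : p ≠ 0) (hp1 : ‖p‖ < 1) (k : ℤ) :
    Tendsto (fun n : ℕ => p ^ (3 * n ^ 2 + (2 * k + 1) * n : ℤ) *
      thetaPartial p (fun s => 2 * s ^ 2) n) atTop (𝓝 0) := by
  have h := (summable_zpow_mul_thetaPartial hp (fun n => by ring)
    (indefSummable_square hp hp1) (k - 1)).tendsto_atTop_zero
  refine h.congr fun n => ?_
  congr 2
  ring

lemma aSeq_one {p : ℂ} (hp : p ≠ 0) (hp1 : ‖p‖ < 1) (hp2 : ‖p ^ 2‖ < 1) :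
    aSeq (p ^ 2) 1 = -p ^ (-2 : ℤ) * eulerJ 1 (p ^ 2) ^ 2 := by
  have h := (hasSum_aSeq hp hp1 1).mul_left (-p ^ (2 : ℤ))
  have hf : ∀ n : ℕ, p ^ (4 * n ^ 2 + 2 * n : ℤ) * (1 - p ^ (4 * n + 2 : ℤ)) *
      thetaPartial p (fun s => s * (3 * s + 1)) n =
      -p ^ (2 : ℤ) * ((p ^ (4 * n ^ 2 + 4 * n + 2 * 1 * n : ℤ) -
      p ^ (4 * n ^ 2 + 4 * n - 2 * 1 * (n + 1) : ℤ)) *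
      thetaPartial p (fun s => s * (3 * s + 1)) n) := by
    intro n
    rw [zpow_eq_mul hp (show (4 * n ^ 2 + 2 * n : ℤ) =
      2 + (4 * n ^ 2 + 4 * n - 2 * 1 * (n + 1)) by ring),
      zpow_eq_mul hp (show (4 * n ^ 2 + 4 * n + 2 * 1 * n : ℤ) =
      (4 * n ^ 2 + 4 * n - 2 * 1 * (n + 1)) + (4 * n + 2) by ring)]
    ring
  have h1 := h.congr_fun hf
  have h2 := tsum_thetaPartial_pentagonal hp hp2 h1.summable
  rw [h1.tsum_eq] at h2
  rw [← h2, zpow_neg]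
  have : p ^ (2 : ℤ) ≠ 0 := zpow_ne_zero _ hp
  field_simp

lemma bSeq_one {p : ℂ} (hp : p ≠ 0) (hp1 : ‖p‖ < 1) (hp2 : ‖p ^ 2‖ < 1) :
    bSeq (p ^ 2) 1 = -p ^ (-2 : ℤ) * eulerJ 1 (p ^ 2) ^ 3 / eulerJ 2 (p ^ 2) := by
  have h := (hasSum_bSeq hp hp1 1).mul_left (-p ^ (2 : ℤ))
  have hf : ∀ n : ℕ, p ^ (n * (3 * n + 1) : ℤ) * (1 - p ^ (4 * n + 2 : ℤ)) *
      thetaPartial p (fun s => 2 * s ^ 2) n =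
      -p ^ (2 : ℤ) * ((p ^ (3 * n ^ 2 + 3 * n + 2 * 1 * n : ℤ) -
      p ^ (3 * n ^ 2 + 3 * n - 2 * 1 * (n + 1) : ℤ)) *
      thetaPartial p (fun s => 2 * s ^ 2) n) := by
    intro n
    rw [zpow_eq_mul hp (show (n * (3 * n + 1) : ℤ) =
      2 + (3 * n ^ 2 + 3 * n - 2 * 1 * (n + 1)) by ring),
      zpow_eq_mul hp (show (3 * n ^ 2 + 3 * n + 2 * 1 * n : ℤ) =
      (3 * n ^ 2 + 3 * n - 2 * 1 * (n + 1)) + (4 * n + 2) by ring)]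
    ring
  have h1 := h.congr_fun hf
  have h2 := tsum_thetaPartial_square hp hp2 h1.summable
  rw [h1.tsum_eq] at h2
  rw [mul_div_assoc, ← h2, zpow_neg]
  have : p ^ (2 : ℤ) ≠ 0 := zpow_ne_zero _ hp
  field_simp

lemma aSeq_two {p : ℂ} (hp : p ≠ 0) (hp1 : ‖p‖ < 1) : aSeq (p ^ 2) 2 = 0 := by
  have h := (hasSum_aSeq hp hp1 2).mul_left (p ^ (4 : ℤ))
  have h4 : p ^ (4 : ℤ) ≠ 0 := zpow_ne_zero _ hp
  refine (mul_eq_zero.mp (tsum_sub_mul_eq_zero (h := fun n : ℕ => p ^ (4 * n ^ 2 : ℤ))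
    (P := thetaPartial p (fun s => s * (3 * s + 1)))
    (R := fun n : ℕ => (-1) ^ n * p ^ (n * (n + 1) : ℤ)) ?_ (fun n => ?_) ?_ ?_
    (h.congr_fun fun n => ?_))).resolve_left h4
  · simp [thetaPartial]
  · rw [thetaPartial_succ_sub]
    push_cast
    have h1 : p ^ (4 * (n + 1) ^ 2 : ℤ) * p ^ (-((n + 1) * (3 * (n + 1) + 1)) : ℤ) = p ^ (n * (n + 1) : ℤ) := by
      rw [← zpow_add₀ hp]; congr 1; ring
    have h2 : p ^ (4 * (n + 1) ^ 2 : ℤ) * p ^ (-(-(n + 1) * (3 * -(n + 1) + 1)) : ℤ) = p ^ ((n + 1) * (n + 1 + 1) : ℤ) := by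
      rw [← zpow_add₀ hp]; congr 1; ring
    linear_combination -(-1) ^ (n + 1) * (h1 + h2)
  · simpa using tendsto_zpow_mul_thetaPartial_pentagonal hp hp1 0
  · exact tendsto_neg_one_pow_mul_zpow hp hp1 0 fun n => by nlinarith [sq_nonneg (n : ℤ)]
  · rw [← mul_assoc, mul_sub, ← zpow_add₀ hp, ← zpow_add₀ hp]
    push_cast
    congr 3 <;> ring

lemma aSeq_three_add {p : ℂ} (hp : p ≠ 0) (hp1 : ‖p‖ < 1) :
    p ^ (6 : ℤ) * aSeq (p ^ 2) 3 + p ^ (2 : ℤ) * aSeq (p ^ 2) 1 = 0 := by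
  have h := ((hasSum_aSeq hp hp1 3).mul_left (p ^ (6 : ℤ))).add
    ((hasSum_aSeq hp hp1 1).mul_left (p ^ (2 : ℤ)))
  refine tsum_sub_mul_eq_zero
    (h := fun n : ℕ => p ^ (4 * n ^ 2 + 2 * n : ℤ) + p ^ (4 * n ^ 2 - 2 * n : ℤ))
    (P := thetaPartial p (fun s => s * (3 * s + 1)))
    -- With `T n = p ^ (n * (n + 3))`, part of the increment is `(-1)^(n+1) (T (n+1) + T (n-2))`, a
    -- shift by three. Since `x^3 + 1 = (x + 1)(x^2 - x + 1)`, its antidifference is `(-1)^n (T n -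
    -- T (n-1) + T (n-2))`.
    (R := fun n : ℕ => (-1) ^ n * p ^ (n * (n + 1) : ℤ) + (-1) ^ n * p ^ (n * (n + 3) : ℤ) -
      (-1) ^ n * p ^ ((n - 1) * (n + 2) : ℤ) + (-1) ^ n * p ^ ((n - 2) * (n + 1) : ℤ))
    ?_ (fun n => ?_) ?_ ?_ (h.congr_fun fun n => ?_)
  · simp [thetaPartial]
  · rw [thetaPartial_succ_sub]
    push_cast
    have h1 : p ^ (4 * (n + 1) ^ 2 + 2 * (n + 1) : ℤ) * p ^ (-((n + 1) * (3 * (n + 1) + 1)) : ℤ) = p ^ ((n + 1) * (n + 1 + 1) : ℤ) := by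
      rw [← zpow_add₀ hp]; congr 1; ring
    have h2 : p ^ (4 * (n + 1) ^ 2 - 2 * (n + 1) : ℤ) * p ^ (-((n + 1) * (3 * (n + 1) + 1)) : ℤ) = p ^ ((n - 2) * (n + 1) : ℤ) := by
      rw [← zpow_add₀ hp]; congr 1; ring
    have h3 : p ^ (4 * (n + 1) ^ 2 + 2 * (n + 1) : ℤ) * p ^ (-(-(n + 1) * (3 * -(n + 1) + 1)) : ℤ) = p ^ ((n + 1) * (n + 1 + 3) : ℤ) := by
      rw [← zpow_add₀ hp]; congr 1; ring
    have h4 : p ^ (4 * (n + 1) ^ 2 - 2 * (n + 1) : ℤ) * p ^ (-(-(n + 1) * (3 * -(n + 1) + 1)) : ℤ) = p ^ (n * (n + 1) : ℤ) := by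
      rw [← zpow_add₀ hp]; congr 1; ring
    rw [show ((n + 1 - 1) * (n + 1 + 2) : ℤ) = n * (n + 3) by ring,
      show ((n + 1 - 2) * (n + 1 + 1) : ℤ) = (n - 1) * (n + 2) by ring]
    linear_combination -(-1) ^ (n + 1) * (h1 + h2 + h3 + h4)
  · have h1 := (tendsto_zpow_mul_thetaPartial_pentagonal hp hp1 1).add
      (tendsto_zpow_mul_thetaPartial_pentagonal hp hp1 (-1))
    rw [add_zero] at h1
    refine h1.congr fun n => ?_
    rw [← add_mul]
    congr 3
  · have hR := fun (E : ℕ → ℤ) => tendsto_neg_one_pow_mul_zpow hp hp1 (E := E) 3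
    simpa using ((((hR fun n => n * (n + 1)) fun n => by nlinarith [sq_nonneg (n : ℤ)]).add
      ((hR fun n => n * (n + 3)) fun n => by nlinarith [sq_nonneg (n : ℤ)])).sub
      ((hR fun n => (n - 1) * (n + 2)) fun n => by nlinarith [sq_nonneg (n : ℤ)])).add
      ((hR fun n => (n - 2) * (n + 1)) fun n => by nlinarith [sq_nonneg ((n : ℤ) - 1)])
  · rw [← mul_assoc, ← mul_assoc, mul_sub, mul_sub, ← zpow_add₀ hp, ← zpow_add₀ hp,
      ← zpow_add₀ hp, ← zpow_add₀ hp, ← add_mul]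
    push_cast
    -- The four weights pair crosswise: each part of `h` gets its value at `n + 1` from one of `k =
    -- 3`, `k = 1` and its value at `n` from the other.
    rw [show (6 + (4 * n ^ 2 + 4 * n + 6 * n) : ℤ) = 4 * (n + 1) ^ 2 + 2 * (n + 1) by ring,
      show (6 + (4 * n ^ 2 + 4 * n - 6 * (n + 1)) : ℤ) = 4 * n ^ 2 - 2 * n by ring,
      show (2 + (4 * n ^ 2 + 4 * n + 2 * n) : ℤ) = 4 * (n + 1) ^ 2 - 2 * (n + 1) by ring,
      show (2 + (4 * n ^ 2 + 4 * n - 2 * (n + 1)) : ℤ) = 4 * n ^ 2 + 2 * n by ring]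
    ring

lemma bSeq_two_add {p : ℂ} (hp : p ≠ 0) (hp1 : ‖p‖ < 1) :
    p ^ (4 : ℤ) * bSeq (p ^ 2) 2 + p ^ (2 : ℤ) * bSeq (p ^ 2) 1 = 0 := by
  have h := ((hasSum_bSeq hp hp1 2).mul_left (p ^ (4 : ℤ))).add
    ((hasSum_bSeq hp hp1 1).mul_left (p ^ (2 : ℤ)))
  refine tsum_sub_mul_eq_zero
    (h := fun n : ℕ => p ^ (3 * n ^ 2 + n : ℤ) + p ^ (3 * n ^ 2 - n : ℤ))
    (P := thetaPartial p (fun s => 2 * s ^ 2))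
    (R := fun n : ℕ => 2 * ((-1) ^ n * p ^ (n * (n + 1) : ℤ)))
    ?_ (fun n => ?_) ?_ ?_ (h.congr_fun fun n => ?_)
  · simp [thetaPartial]
    norm_num
  · rw [thetaPartial_succ_sub]
    push_cast
    have h1 : p ^ (3 * (n + 1) ^ 2 + (n + 1) : ℤ) * p ^ (-(2 * (n + 1) ^ 2) : ℤ) = p ^ ((n + 1) * (n + 1 + 1) : ℤ) := by
      rw [← zpow_add₀ hp]; congr 1; ring
    have h2 : p ^ (3 * (n + 1) ^ 2 - (n + 1) : ℤ) * p ^ (-(2 * (n + 1) ^ 2) : ℤ) = p ^ (n * (n + 1) : ℤ) := by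
      rw [← zpow_add₀ hp]; congr 1; ring
    have h3 : p ^ (3 * (n + 1) ^ 2 + (n + 1) : ℤ) * p ^ (-(2 * (-(n + 1)) ^ 2) : ℤ) = p ^ ((n + 1) * (n + 1 + 1) : ℤ) := by
      rw [← zpow_add₀ hp]; congr 1; ring
    have h4 : p ^ (3 * (n + 1) ^ 2 - (n + 1) : ℤ) * p ^ (-(2 * (-(n + 1)) ^ 2) : ℤ) = p ^ (n * (n + 1) : ℤ) := by
      rw [← zpow_add₀ hp]; congr 1; ring
    linear_combination -(-1) ^ (n + 1) * (h1 + h2 + h3 + h4)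
  · have h1 := (tendsto_zpow_mul_thetaPartial_square hp hp1 0).add
      (tendsto_zpow_mul_thetaPartial_square hp hp1 (-1))
    rw [add_zero] at h1
    refine h1.congr fun n => ?_
    rw [← add_mul]
    congr 3 <;> ring
  · simpa using (tendsto_neg_one_pow_mul_zpow hp hp1 (E := fun n => n * (n + 1)) 0 fun n => by
      nlinarith [sq_nonneg (n : ℤ)]).const_mul 2
  · rw [← mul_assoc, ← mul_assoc, mul_sub, mul_sub, ← zpow_add₀ hp, ← zpow_add₀ hp,
      ← zpow_add₀ hp, ← zpow_add₀ hp, ← add_mul]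
    push_cast
    rw [show (4 + (3 * n ^ 2 + 3 * n + 4 * n) : ℤ) = 3 * (n + 1) ^ 2 + (n + 1) by ring,
      show (4 + (3 * n ^ 2 + 3 * n - 4 * (n + 1)) : ℤ) = 3 * n ^ 2 - n by ring,
      show (2 + (3 * n ^ 2 + 3 * n + 2 * n) : ℤ) = 3 * (n + 1) ^ 2 - (n + 1) by ring,
      show (2 + (3 * n ^ 2 + 3 * n - 2 * (n + 1)) : ℤ) = 3 * n ^ 2 + n by ring]
    ring

theorem mainTheorem2 (q : ℂ) (hq0 : q ≠ 0) (hq1 : ‖q‖ < 1) :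
    -- all the series and products involved converge, and the denominator `J_2` is nonzero
    ((∀ k : ℤ, HeckeSummable 4 4 1 (-q ^ (4 + k)) (q ^ (2 + k)) q) ∧
      (∀ k : ℤ, HeckeSummable 3 3 1 (-q ^ (3 + k)) (q ^ (2 + k)) q) ∧
      (∀ m : ℕ, 0 < m → Multipliable (fun i : ℕ => 1 - q ^ (m * (i + 1)))) ∧
      eulerJ 2 q ≠ 0) ∧
    -- the evaluations
    (aSeq q 0 = 0 ∧
      aSeq q 1 = -q ^ (-1 : ℤ) * eulerJ 1 q ^ 2 ∧
      aSeq q 2 = 0 ∧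
      aSeq q 3 = q ^ (-3 : ℤ) * eulerJ 1 q ^ 2) ∧
    (bSeq q 0 = 0 ∧
      bSeq q 1 = -q ^ (-1 : ℤ) * eulerJ 1 q ^ 3 / eulerJ 2 q ∧
      bSeq q 2 = q ^ (-2 : ℤ) * eulerJ 1 q ^ 3 / eulerJ 2 q) := by
  obtain ⟨p, rfl⟩ := IsAlgClosed.exists_pow_nat_eq q two_pos
  have hp : p ≠ 0 := by rintro rfl; simp at hq0
  have hp1 : ‖p‖ < 1 := by
    rw [norm_pow] at hq1
    exact (sq_lt_one_iff₀ (norm_nonneg p)).mp hq1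
  have ha1 := aSeq_one hp hp1 hq1
  have hb1 := bSeq_one hp hp1 hq1
  have ha3 := aSeq_three_add hp hp1
  have hb2 := bSeq_two_add hp hp1
  refine ⟨⟨fun k => ?_, fun k => ?_, fun m hm => multipliable_eulerJ hq1 hm,
    eulerJ_ne_zero hq1 two_pos⟩, ⟨by simp [aSeq], ?_, aSeq_two hp hp1, ?_⟩,
    ⟨by simp [bSeq], ?_, ?_⟩⟩
  · simp only [HeckeSummable, heckeTerm_four hp]
    exact indefSummable_pentagonal hp hp1 k
  · simp only [HeckeSummable, heckeTerm_three hp]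
    exact indefSummable_square hp hp1 k
  · rw [ha1, sq_zpow]; norm_num
  · rw [ha1] at ha3
    have h6 : p ^ (6 : ℤ) ≠ 0 := zpow_ne_zero _ hp
    have h2 : p ^ (2 : ℤ) ≠ 0 := zpow_ne_zero _ hp
    rw [zpow_neg, neg_mul, mul_neg, mul_inv_cancel_left₀ h2] at ha3
    rw [sq_zpow, show (2 * -3 : ℤ) = -6 by norm_num, zpow_neg, eq_inv_mul_iff_mul_eq₀ h6]
    linear_combination ha3
  · rw [hb1, sq_zpow]; norm_num
  · rw [hb1] at hb2
    have h4 : p ^ (4 : ℤ) ≠ 0 := zpow_ne_zero _ hp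
    have h2 : p ^ (2 : ℤ) ≠ 0 := zpow_ne_zero _ hp
    rw [mul_div_assoc, zpow_neg, neg_mul, mul_neg, mul_inv_cancel_left₀ h2] at hb2
    rw [sq_zpow, show (2 * -2 : ℤ) = -4 by norm_num, mul_div_assoc, zpow_neg,
      eq_inv_mul_iff_mul_eq₀ h4]
    linear_combination hb2
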